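/- Let $E,A\in\mathbb{C}^{n\times n}$, $B\in\mathbb{C}^{n\times m}$, $C\in\mathbb{C}^{m\times n}$. The descriptor system $E\dot x=Ax+Bu$, $y=Cx$ is called \emph{port-Hamiltonian (pH) with structure matrix} $Q\in\mathbb{C}^{n\times n}$ if there are $J,R\in\mathbb{C}^{n\times n}$ and $G,P\in\mathbb{C}^{n\times m}$ with $A=(J-R)Q$, $B=G-P$, $C=(G+P)^*Q$ and $$Q^*E=E^*Q\ge 0,\qquad Q^*JQ=-(Q^*JQ)^*,\qquad Q^*RQ\ge 0,\qquad Q^*P=0,$$ where $M\ge 0$ means that $M$ is Hermitian positive semidefinite; it is called \emph{pH} if it is pH with some structure matrix $Q$. A pair $(E,A)$ is \emph{regular} if $\det(sE-A)\ne 0$ for some $s\in\mathbb{C}$, \emph{impulse-free} if $\deg\det(sE-A)=\operatorname{rank}E$, and \emph{asymptotically stable} if every $s\in\mathbb{C}$ with $\det(sE-A)=0$ satisfies $\Re(s)<0$. For a matrix $M$, let $S_\infty(M)$ (respectively $T_\infty(M)$) denote any matrix whose columns form an orthonormal basis of the right nullspace $\{x: Mx=0\}$ (respectively the left nullspace $\{y: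 y^*M=0\}$), and put $$T_a=T_\infty\big(E\,S_\infty(C)\big),\qquad S_b=S_\infty\left(\begin{bmatrix}E\\ \big(T_\infty([E\ \ B])\big)^*A\\ C\end{bmatrix}\right).$$ \textbf{Theorem.} Let the system $E\dot x=Ax+Bu$, $y=Cx$ be pH and let $r$ be an integer. For every choice of the orthonormal nullspace bases in $T_a$ and $S_b$, there exist $K,F\in\mathbb{C}^{m\times m}$ such that the pair $(E+BFC,\,A-BKC)$ is regular, impulse-free and asymptotically stable, $\operatorname{rank}(E+BFC)=r$, and the closed-loop system $(E+BFC)\dot x=(A-BKC)x+Bv$, $y=Cx$ is pH, if and only if the following three conditions hold: (i) $T_a^*AS_b$ has full column rank; (ii) for all $s\in\mathbb{C}$ with $\Re(s)=0$, $$\operatorname{rank}\begin{bmatrix}sE-A & B\end{bmatrix}=\operatorname{rank}\begin{bmatrix}sE-A\\ C\end{bmatrix}=n;$$ (iii) $\operatorname{rank}[E\ \ B]-\operatorname{rank}B\ \le\ r\ \le\ \operatorname{rank}[E\ \ B]-\operatorname{rank}(T_a^*AS_b)$. The same equivalence holds if, for any $Q$ with which the given system is pH, the closed-loop system is required to be pH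 with that same structure matrix $Q$. -/

import Mathlib

open scoped Matrix ComplexOrder

namespace DescriptorSystem

/-- The finite generalized eigenvalues of the pair `(E, A)`. -/
def finiteSpectrum {n : ℕ} (E A : Matrix (Fin n) (Fin n) ℂ) : Set ℂ :=
  {s : ℂ | (s • E - A).det = 0}

/-- The polynomial `det (s E - A)` in the indeterminate `s`. -/
noncomputable def charPoly {n : ℕ} (E A : Matrix (Fin n) (Fin n) ℂ) : Polynomial ℂ :=
  ((Polynomial.X : Polynomial ℂ) • E.map Polynomial.C - A.map Polynomial.C).det

/-- The pair `(E, A)` is regular: `det (s E - A) ≠ 0` for some scalar `s`. -/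
def IsRegular {n : ℕ} (E A : Matrix (Fin n) (Fin n) ℂ) : Prop :=
  ∃ s : ℂ, (s • E - A).det ≠ 0

/-- The pair `(E, A)` is impulse-free: `deg (det (s E - A)) = rank E`.
The zero polynomial has degree `⊥`, so an impulse-free pair is regular. -/
def IsImpulseFree {n : ℕ} (E A : Matrix (Fin n) (Fin n) ℂ) : Prop :=
  (charPoly E A).degree = (E.rank : WithBot ℕ)

/-- The pair `(E, A)` is asymptotically stable: all finite eigenvalues lie in the open left
half plane. -/
def IsAsymptoticallyStable {n : ℕ} (E A : Matrix (Fin n) (Fin n) ℂ) : Prop :=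
  finiteSpectrum E A ⊆ {s : ℂ | s.re < 0}

/-- The system `E x' = A x + B u`, `y = C x` is port-Hamiltonian with structure matrix `Q`.
`Matrix.PosSemidef` includes being Hermitian. -/
def IsPortHamiltonianWith {n m : ℕ} (Q E A : Matrix (Fin n) (Fin n) ℂ)
    (B : Matrix (Fin n) (Fin m) ℂ) (C : Matrix (Fin m) (Fin n) ℂ) : Prop :=
  ∃ (J R : Matrix (Fin n) (Fin n) ℂ) (G P : Matrix (Fin n) (Fin m) ℂ),
    A = (J - R) * Q ∧ B = G - P ∧ C = (G + P)ᴴ * Q ∧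
    Qᴴ * E = Eᴴ * Q ∧ (Qᴴ * E).PosSemidef ∧
    Qᴴ * J * Q = -(Qᴴ * J * Q)ᴴ ∧ (Qᴴ * R * Q).PosSemidef ∧ Qᴴ * P = 0

/-- The system `E x' = A x + B u`, `y = C x` is port-Hamiltonian. -/
def IsPortHamiltonian {n m : ℕ} (E A : Matrix (Fin n) (Fin n) ℂ)
    (B : Matrix (Fin n) (Fin m) ℂ) (C : Matrix (Fin m) (Fin n) ℂ) : Prop :=
  ∃ Q : Matrix (Fin n) (Fin n) ℂ, IsPortHamiltonianWith Q E A B C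

/-- The columns of `S` are orthonormal and span the right nullspace `{x | M x = 0}` of `M`. -/
def IsRightNullBasis {p q : Type*} [Fintype p] [Fintype q] {k : ℕ}
    (M : Matrix p q ℂ) (S : Matrix q (Fin k) ℂ) : Prop :=
  Sᴴ * S = 1 ∧ ∀ x : q → ℂ, M *ᵥ x = 0 ↔ ∃ c : Fin k → ℂ, x = S *ᵥ c

/-- The columns of `T` are orthonormal and span the left nullspace `{y | y* M = 0}` of `M`. -/
def IsLeftNullBasis {p q : Type*} [Fintype p] [Fintype q] {k : ℕ}
    (M : Matrix p q ℂ) (T : Matrix p (Fin k) ℂ) : Prop :=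
  Tᴴ * T = 1 ∧ ∀ y : p → ℂ, star y ᵥ* M = 0 ↔ ∃ c : Fin k → ℂ, y = T *ᵥ c

/-- `T_a` spans the left nullspace of `E S`, where `S` spans the right nullspace of `C`. -/
def IsTa {n m k : ℕ} (E : Matrix (Fin n) (Fin n) ℂ) (C : Matrix (Fin m) (Fin n) ℂ)
    (Ta : Matrix (Fin n) (Fin k) ℂ) : Prop :=
  ∃ (l : ℕ) (S : Matrix (Fin n) (Fin l) ℂ), IsRightNullBasis C S ∧ IsLeftNullBasis (E * S) Ta

/-- `S_b` spans the right nullspace of `[E; T* A; C]`, where `T` spans the left nullspace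
of `[E B]`. -/
def IsSb {n m k : ℕ} (E A : Matrix (Fin n) (Fin n) ℂ)
    (B : Matrix (Fin n) (Fin m) ℂ) (C : Matrix (Fin m) (Fin n) ℂ)
    (Sb : Matrix (Fin n) (Fin k) ℂ) : Prop :=
  ∃ (l : ℕ) (T : Matrix (Fin n) (Fin l) ℂ), IsLeftNullBasis (Matrix.fromCols E B) T ∧
    IsRightNullBasis (Matrix.fromRows E (Matrix.fromRows (Tᴴ * A) C)) Sb

/-- The three solvability conditions, for given matrices `T_a` and `S_b`. -/
def SolvabilityConditions {n m k l : ℕ} (E A : Matrix (Fin n) (Fin n) ℂ)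
    (B : Matrix (Fin n) (Fin m) ℂ) (C : Matrix (Fin m) (Fin n) ℂ)
    (Ta : Matrix (Fin n) (Fin k) ℂ) (Sb : Matrix (Fin n) (Fin l) ℂ) (r : ℤ) : Prop :=
  (Taᴴ * A * Sb).rank = l ∧
  (∀ s : ℂ, s.re = 0 →
    (Matrix.fromCols (s • E - A) B).rank = n ∧ (Matrix.fromRows (s • E - A) C).rank = n) ∧
  ((Matrix.fromCols E B).rank : ℤ) - (B.rank : ℤ) ≤ r ∧
  r ≤ ((Matrix.fromCols E B).rank : ℤ) - ((Taᴴ * A * Sb).rank : ℤ)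

end DescriptorSystem

/-!
Write `M = Qᴴ * E` and `W = -(Qᴴ * A + Aᴴ * Q)`, both positive semidefinite. Since `C = Bᴴ * Q`,
the feedback `F` replaces `M` by `M + Cᴴ * F * C`, and `K` replaces `W` by
`W + Cᴴ * (K + Kᴴ) * C`; condition (ii) at `s = 0` makes `Q` invertible, so ranks and ranges of
`E + B * F * C` can be read off from `M + Cᴴ * F * C`.

The ranges of the positive semidefinite matrices `M + Cᴴ * F * C` all contain `M (ker C)`. This
minimum is attained: for `M = Xᴴ * X`, compress by the orthogonal projection onto `X (ker C)`.
Adding the orthogonal projection onto a subspace `T` of `range Cᴴ` enlarges the range to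
`M (ker C) ⊔ T`. A `T` of the required dimension can be chosen so that this range is disjoint from
the image of `range Sb` under `Qᴴ * A`: condition (i) says that `M (ker C)` is disjoint from that
image, and (iii) leaves the necessary room.

With `K = 1`, a closed-loop eigenvector for an eigenvalue with nonnegative real part, or an
impulsive direction, is annihilated by the new dissipation matrix, hence by `C`, hence is not
affected by the feedback. Eigenvectors of this kind are excluded by (ii), impulsive directions by
the choice of `T`.

Conversely, for invertible `A₁` the pair `(E₁, A₁)` is impulse-free exactly when no nonzero
`x ∈ ker E₁` has `A₁ *ᵥ x ∈ range E₁`. The closed-loop pair agrees with the given one on `ker C`.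
-/

namespace DescriptorSystem

open LinearMap Matrix Module

section Subspaces

variable {K V : Type*} [Field K] [AddCommGroup V] [Module K V]

theorem exists_submodule_le_finrank_eq (U : Submodule K V) {d : ℕ} (hd : d ≤ finrank K U) :
    ∃ T ≤ U, finrank K T = d := by
  obtain ⟨f, hf⟩ := exists_linearIndependent_of_le_finrank hd
  refine ⟨(Submodule.span K (Set.range f)).map U.subtype, Submodule.map_subtype_le _ _, ?_⟩
  rw [Submodule.finrank_map_subtype_eq, finrank_span_eq_card hf, Fintype.card_fin]

theorem maxGenEigenspace_zero_eq_ker_iff {f : End K V} :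
    f.maxGenEigenspace 0 = ker f ↔ Disjoint (ker f) (range f) := by
  rw [Submodule.disjoint_def]
  constructor
  · rintro h _ hx ⟨z, rfl⟩
    have hz : z ∈ f.maxGenEigenspace 0 :=
      (End.mem_maxGenEigenspace f 0 z).2 ⟨2, by simpa [pow_two] using hx⟩
    rwa [h] at hz
  · intro h
    refine le_antisymm (fun x hx => ?_) fun x hx =>
      (End.mem_maxGenEigenspace f 0 x).2 ⟨1, by simpa using hx⟩
    obtain ⟨k, hk⟩ := (End.mem_maxGenEigenspace f 0 x).1 hx
    rw [zero_smul, sub_zero] at hk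
    clear hx
    induction k generalizing x with
    | zero => simp_all
    | succ k ih =>
      rw [pow_succ, End.mul_apply] at hk
      exact h _ (ih _ hk) (mem_range_self f x)

variable [FiniteDimensional K V]

theorem finrank_sup_of_disjoint {U W : Submodule K V} (h : Disjoint U W) :
    finrank K ↥(U ⊔ W) = finrank K U + finrank K W := by
  rw [← Submodule.finrank_sup_add_finrank_inf_eq, h.eq_bot, finrank_bot, add_zero]

theorem exists_finrank_sup_eq_disjoint {Z L R : Submodule K V} (hZL : Disjoint Z L) {r : ℕ}
    (hlow : finrank K Z ≤ r) (hupp : r + finrank K L ≤ finrank K ↥(Z ⊔ R)) :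
    ∃ T ≤ R, finrank K ↥(Z ⊔ T) = r ∧ Disjoint (Z ⊔ T) L := by
  obtain ⟨R', hdisj, hR'⟩ :=
    IsModularLattice.exists_disjoint_and_sup_eq (inf_le_right : (Z ⊔ L) ⊓ R ≤ R)
  have hR'R : R' ≤ R := hR' ▸ le_sup_right
  have hZLR' : Disjoint (Z ⊔ L) R' := by
    rw [disjoint_iff, ← inf_eq_right.2 hR'R, ← inf_assoc]
    exact hdisj.eq_bot
  have hsup : Z ⊔ R ≤ Z ⊔ L ⊔ R' := by
    rw [← hR']
    exact sup_le (le_sup_left.trans le_sup_left)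
      (sup_le (inf_le_left.trans le_sup_left) le_sup_right)
  have hdim : finrank K ↥(Z ⊔ L ⊔ R') = finrank K Z + finrank K L + finrank K R' := by
    rw [finrank_sup_of_disjoint hZLR', finrank_sup_of_disjoint hZL]
  obtain ⟨T, hTR', hT⟩ := exists_submodule_le_finrank_eq R' (d := r - finrank K Z) (by
    have := Submodule.finrank_mono hsup
    omega)
  have hZLT : Disjoint (Z ⊔ L) T := hZLR'.mono_right hTR'
  refine ⟨T, hTR'.trans hR'R, ?_, ?_⟩
  · rw [finrank_sup_of_disjoint (hZLT.mono_left le_sup_left), hT]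
    omega
  · exact (hZL.symm.disjoint_sup_right_of_disjoint_sup_left (sup_comm Z L ▸ hZLT)).symm

end Subspaces

section CommRing

variable {R o p q t : Type*} [CommRing R] [Fintype q]

theorem ker_mulVecLin_fromRows (A : Matrix o q R) (B : Matrix p q R) :
    ker (fromRows A B).mulVecLin = ker A.mulVecLin ⊓ ker B.mulVecLin := by
  ext x
  simp only [mem_ker, Submodule.mem_inf, mulVecLin_apply, fromRows_mulVec,
    ← Sum.elim_zero_zero, Sum.elim_eq_iff]

theorem add_mul_mulVec_of_mulVec_eq_zero [Fintype t] {C : Matrix t q R} {x : q → R}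
    (hx : C *ᵥ x = 0) (A : Matrix p q R) (B : Matrix p t R) : (A + B * C) *ᵥ x = A *ᵥ x := by
  rw [add_mulVec, ← mulVec_mulVec, hx, mulVec_zero, add_zero]

theorem sub_mul_mulVec_of_mulVec_eq_zero [Fintype t] {C : Matrix t q R} {x : q → R}
    (hx : C *ᵥ x = 0) (A : Matrix p q R) (B : Matrix p t R) : (A - B * C) *ᵥ x = A *ᵥ x := by
  rw [sub_mulVec, ← mulVec_mulVec, hx, mulVec_zero, sub_zero]

theorem range_mulVecLin_mul [Fintype t] (A : Matrix p q R) (B : Matrix q t R) :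
    range (A * B).mulVecLin = (range B.mulVecLin).map A.mulVecLin := by
  rw [mulVecLin_mul, range_comp]

theorem range_mulVecLin_fromCols [Fintype t] (A : Matrix p q R) (B : Matrix p t R) :
    range (fromCols A B).mulVecLin = range A.mulVecLin ⊔ range B.mulVecLin := by
  simp only [range_mulVecLin, ← Submodule.span_union]
  congr 1
  ext x
  simp only [Set.mem_union, Set.mem_range, Sum.exists]
  rfl

theorem range_mulVecLin_add_mul_sup [Fintype t] (A : Matrix p q R) (B : Matrix p t R)
    (C : Matrix t q R) :
    range (A + B * C).mulVecLin ⊔ range B.mulVecLin = range A.mulVecLin ⊔ range B.mulVecLin := by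
  have range_add_mul_le (A : Matrix p q R) (C : Matrix t q R) :
      range (A + B * C).mulVecLin ≤ range A.mulVecLin ⊔ range B.mulVecLin := by
    rw [mulVecLin_add, mulVecLin_mul]
    exact (range_add_le _ _).trans (sup_le_sup_left (range_comp_le_range _ _) _)
  refine le_antisymm (sup_le (range_add_mul_le A C) le_sup_right) (sup_le ?_ le_sup_right)
  simpa [add_assoc, ← Matrix.mul_add] using range_add_mul_le (A + B * C) (-C)

end CommRing

section Field

variable {K p q t : Type*} [Field K] [Fintype q]

theorem rank_eq_card_iff {A : Matrix p q K} :
    A.rank = Fintype.card q ↔ ker A.mulVecLin = ⊥ := by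
  have := finrank_range_add_finrank_ker A.mulVecLin
  rw [finrank_fintype_fun_eq_card] at this
  rw [Matrix.rank, ← Submodule.finrank_eq_zero]
  omega

theorem rank_fromCols_add_mul [Fintype t] (A : Matrix p q K) (B : Matrix p t K)
    (C : Matrix t q K) : (fromCols (A + B * C) B).rank = (fromCols A B).rank := by
  rw [Matrix.rank, Matrix.rank, range_mulVecLin_fromCols, range_mulVecLin_fromCols,
    range_mulVecLin_add_mul_sup]

theorem rank_fromCols_le [Finite p] [Fintype t] (A : Matrix p q K) (B : Matrix p t K) :
    (fromCols A B).rank ≤ A.rank + B.rank := by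
  rw [Matrix.rank, range_mulVecLin_fromCols]
  exact Submodule.finrank_add_le_finrank_add_finrank _ _

theorem exists_mul_mul_eq_self [Fintype p] (C : Matrix p q K) :
    ∃ G : Matrix q p K, C * G * C = C := by
  classical
  obtain ⟨g, hg⟩ := C.mulVecLin.rangeRestrict.exists_rightInverse_of_surjective
    C.mulVecLin.range_rangeRestrict
  obtain ⟨G, hG⟩ := LinearMap.exists_extend g
  refine ⟨G.toMatrix', toLin'.injective <| LinearMap.ext fun x => ?_⟩
  have hGx : G (C *ᵥ x) = g (C.mulVecLin.rangeRestrict x) :=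
    LinearMap.congr_fun hG (C.mulVecLin.rangeRestrict x)
  have hgx : C *ᵥ g (C.mulVecLin.rangeRestrict x) = C *ᵥ x :=
    congrArg Subtype.val (LinearMap.congr_fun hg (C.mulVecLin.rangeRestrict x))
  rw [toLin'_apply, toLin'_apply, ← mulVec_mulVec, ← mulVec_mulVec, toMatrix'_mulVec, hGx, hgx]

variable [Fintype t] [DecidableEq q] {A : Matrix q q K}

theorem rank_fromCols_eq_card_of_isUnit_det {B : Matrix q t K} {C : Matrix t q K}
    (h : IsUnit (A + B * C).det) : (fromCols A B).rank = Fintype.card q := by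
  refine le_antisymm (rank_le_card_height _) ?_
  rw [← rank_fromCols_add_mul A B C, ← rank_of_isUnit _ ((Matrix.isUnit_iff_isUnit_det _).2 h),
    Matrix.rank, Matrix.rank, range_mulVecLin_fromCols]
  exact Submodule.finrank_mono le_sup_left

theorem rank_fromRows_eq_card_of_isUnit_det {B : Matrix q t K} {C : Matrix t q K}
    (h : IsUnit (A + B * C).det) : (fromRows A C).rank = Fintype.card q := by
  rw [rank_eq_card_iff, ker_mulVecLin_fromRows, eq_bot_iff]
  rintro x ⟨hA, hC⟩
  rw [SetLike.mem_coe, mem_ker, mulVecLin_apply] at hA hC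
  refine eq_zero_of_mulVec_eq_zero h.ne_zero ?_
  rwa [add_mul_mulVec_of_mulVec_eq_zero hC]

end Field

section PosSemidef

variable {𝕜 p q : Type*} [RCLike 𝕜] [Fintype p] [Fintype q]

theorem exists_conjTranspose_mul_mul_eq {C : Matrix p q 𝕜} {H : Matrix q q 𝕜}
    (hH : H.IsHermitian) (hker : ∀ x, C *ᵥ x = 0 → H *ᵥ x = 0) :
    ∃ F : Matrix p p 𝕜, Cᴴ * F * C = H := by
  classical
  obtain ⟨G, hG⟩ := exists_mul_mul_eq_self C
  have hHG : H * G * C = H := by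
    refine toLin'.injective <| LinearMap.ext fun x => ?_
    have hC : C *ᵥ ((G * C) *ᵥ x - x) = 0 := by
      rw [mulVec_sub, mulVec_mulVec, ← Matrix.mul_assoc, hG, sub_self]
    rw [toLin'_apply, toLin'_apply, Matrix.mul_assoc, ← mulVec_mulVec, ← sub_eq_zero,
      ← mulVec_sub, hker _ hC]
  have hGH : Cᴴ * (Gᴴ * H) = H := by
    simpa [Matrix.conjTranspose_mul, hH.eq] using congrArg conjTranspose hHG
  exact ⟨Gᴴ * H * G, by rw [← Matrix.mul_assoc, hGH, hHG]⟩

theorem exists_isStarProjection_range_eq (V : Submodule 𝕜 (q → 𝕜)) :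
    ∃ P : Matrix q q 𝕜, IsStarProjection P ∧ range P.mulVecLin = V := by
  classical
  let U : Submodule 𝕜 (EuclideanSpace 𝕜 q) := V.comap (WithLp.linearEquiv 2 𝕜 (q → 𝕜)).toLinearMap
  let φ := toEuclideanCLM (n := q) (𝕜 := 𝕜)
  have hφ (x : q → 𝕜) : φ.symm U.starProjection *ᵥ x = (U.starProjection (.toLp 2 x)).ofLp := by
    rw [← ofLp_toEuclideanCLM, φ.apply_symm_apply]
  refine ⟨φ.symm U.starProjection, isStarProjection_starProjection.map φ.symm, ?_⟩
  apply le_antisymm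
  · rintro _ ⟨x, rfl⟩
    rw [mulVecLin_apply, hφ]
    exact U.starProjection_apply_mem _
  · intro v hv
    refine ⟨v, ?_⟩
    rw [mulVecLin_apply, hφ, Submodule.starProjection_eq_self_iff.2 hv]

open scoped MatrixOrder Matrix.Norms.L2Operator in
theorem exists_eq_conjTranspose_mul_self {M : Matrix q q 𝕜} (hM : M.PosSemidef) :
    ∃ X : Matrix q q 𝕜, M = Xᴴ * X := by
  classical
  exact CStarAlgebra.nonneg_iff_eq_star_mul_self.mp hM.nonneg

open scoped MatrixOrder in
theorem posSemidef_of_isStarProjection {P : Matrix q q 𝕜} (hP : IsStarProjection P) :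
    P.PosSemidef :=
  hP.nonneg.posSemidef

theorem range_mulVecLin_conjTranspose_mul_self (X : Matrix p q 𝕜) :
    range (Xᴴ * X).mulVecLin = range Xᴴ.mulVecLin := by
  refine Submodule.eq_of_le_of_finrank_eq ?_ ?_
  · rw [mulVecLin_mul]
    exact range_comp_le_range _ _
  · exact (rank_conjTranspose_mul_self X).trans (rank_conjTranspose X).symm

theorem range_mulVecLin_add_of_posSemidef {M N : Matrix q q 𝕜} (hM : M.PosSemidef)
    (hN : N.PosSemidef) : range (M + N).mulVecLin = range M.mulVecLin ⊔ range N.mulVecLin := by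
  obtain ⟨X, rfl⟩ := exists_eq_conjTranspose_mul_self hM
  obtain ⟨Y, rfl⟩ := exists_eq_conjTranspose_mul_self hN
  have hsum : Xᴴ * X + Yᴴ * Y = (fromRows X Y)ᴴ * fromRows X Y := by
    rw [conjTranspose_fromRows_eq_fromCols_conjTranspose, fromCols_mul_fromRows]
  rw [hsum, range_mulVecLin_conjTranspose_mul_self,
    conjTranspose_fromRows_eq_fromCols_conjTranspose, range_mulVecLin_fromCols,
    range_mulVecLin_conjTranspose_mul_self, range_mulVecLin_conjTranspose_mul_self]

variable {M : Matrix q q 𝕜}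

theorem disjoint_map_ker_range_conjTranspose (hM : M.PosSemidef) (C : Matrix p q 𝕜) :
    Disjoint ((ker C.mulVecLin).map M.mulVecLin) (range Cᴴ.mulVecLin) := by
  rw [Submodule.disjoint_def]
  rintro _ ⟨z, hz, rfl⟩ ⟨w, hw⟩
  rw [SetLike.mem_coe, mem_ker, mulVecLin_apply] at hz
  rw [mulVecLin_apply, mulVecLin_apply] at hw
  rw [mulVecLin_apply, ← hM.dotProduct_mulVec_zero_iff, ← hw, dotProduct_mulVec,
    ← star_mulVec, hz, star_zero, zero_dotProduct]

theorem exists_posSemidef_range_eq_map_ker (hM : M.PosSemidef) (C : Matrix p q 𝕜) :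
    ∃ F : Matrix p p 𝕜, (M + Cᴴ * F * C).PosSemidef ∧
      range (M + Cᴴ * F * C).mulVecLin = (ker C.mulVecLin).map M.mulVecLin := by
  obtain ⟨X, rfl⟩ := exists_eq_conjTranspose_mul_self hM
  -- Compressing `Xᴴ * X` to the image of `ker C` under `X` changes nothing on `ker C`.
  obtain ⟨P, hP, hrange⟩ :=
    exists_isStarProjection_range_eq ((ker C.mulVecLin).map X.mulVecLin)
  have hPH : Pᴴ = P := hP.isSelfAdjoint
  have hPP : P * P = P := hP.isIdempotentElem
  have hD : Xᴴ * P * X = (P * X)ᴴ * (P * X) := by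
    rw [conjTranspose_mul, hPH, ← Matrix.mul_assoc, Matrix.mul_assoc Xᴴ P P, hPP]
  have hagree : ∀ x, C *ᵥ x = 0 → (Xᴴ * P * X - Xᴴ * X) *ᵥ x = 0 := by
    intro x hx
    obtain ⟨w, hw⟩ : X *ᵥ x ∈ range P.mulVecLin := hrange ▸ Submodule.mem_map_of_mem hx
    rw [mulVecLin_apply] at hw
    rw [sub_mulVec, ← mulVec_mulVec, ← mulVec_mulVec, ← mulVec_mulVec, ← hw,
      mulVec_mulVec w P P, hPP, sub_self]
  obtain ⟨F, hF⟩ := exists_conjTranspose_mul_mul_eq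
    ((hD ▸ isHermitian_conjTranspose_mul_self _).sub (isHermitian_conjTranspose_mul_self _)) hagree
  refine ⟨F, ?_, ?_⟩ <;> rw [hF, add_sub_cancel, hD]
  · exact posSemidef_conjTranspose_mul_self _
  · rw [range_mulVecLin_conjTranspose_mul_self, conjTranspose_mul, hPH,
      range_mulVecLin_mul, hrange, mulVecLin_mul, Submodule.map_comp]

theorem exists_posSemidef_rank_eq_disjoint (hM : M.PosSemidef) (C : Matrix p q 𝕜)
    {L : Submodule 𝕜 (q → 𝕜)} (hL : Disjoint ((ker C.mulVecLin).map M.mulVecLin) L) {r : ℕ}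
    (hlow : (fromCols M Cᴴ).rank ≤ r + Cᴴ.rank)
    (hupp : r + finrank 𝕜 L ≤ (fromCols M Cᴴ).rank) :
    ∃ F : Matrix p p 𝕜, (M + Cᴴ * F * C).PosSemidef ∧ (M + Cᴴ * F * C).rank = r ∧
      Disjoint (range (M + Cᴴ * F * C).mulVecLin) L := by
  obtain ⟨F₀, hF₀, hrange₀⟩ := exists_posSemidef_range_eq_map_ker hM C
  have hsup : (fromCols M Cᴴ).rank =
      finrank 𝕜 ↥((ker C.mulVecLin).map M.mulVecLin ⊔ range Cᴴ.mulVecLin) := by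
    rw [← rank_fromCols_add_mul M Cᴴ (F₀ * C), ← Matrix.mul_assoc, Matrix.rank,
      range_mulVecLin_fromCols, hrange₀]
  have hdisj := disjoint_map_ker_range_conjTranspose hM C
  obtain ⟨T, hTC, hTr, hTL⟩ := exists_finrank_sup_eq_disjoint hL (r := r)
    (R := range Cᴴ.mulVecLin)
    (by rw [hsup, finrank_sup_of_disjoint hdisj] at hlow; exact Nat.le_of_add_le_add_right hlow)
    (hsup ▸ hupp)
  obtain ⟨P, hP, hrange⟩ := exists_isStarProjection_range_eq T
  have hPpos := posSemidef_of_isStarProjection hP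
  have hPker : ∀ x, C *ᵥ x = 0 → P *ᵥ x = 0 := fun x hx =>
    (disjoint_map_ker_range_conjTranspose hPpos C).le_bot
      ⟨Submodule.mem_map_of_mem hx, hTC (hrange ▸ mem_range_self P.mulVecLin x)⟩
  obtain ⟨F₁, hF₁⟩ := exists_conjTranspose_mul_mul_eq hPpos.1 hPker
  have hF : M + Cᴴ * (F₀ + F₁) * C = (M + Cᴴ * F₀ * C) + P := by
    rw [← hF₁, Matrix.mul_add, Matrix.add_mul, add_assoc]
  have hrangeF : range (M + Cᴴ * (F₀ + F₁) * C).mulVecLin =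
      (ker C.mulVecLin).map M.mulVecLin ⊔ T := by
    rw [hF, range_mulVecLin_add_of_posSemidef hF₀ hPpos, hrange₀, hrange]
  exact ⟨F₀ + F₁, hF ▸ hF₀.add hPpos, by rw [Matrix.rank, hrangeF, hTr], hrangeF ▸ hTL⟩

end PosSemidef

section ImpulseFree

theorem natDegree_charpolyRev_eq_rank_iff {K q : Type*} [Field K] [Fintype q] [DecidableEq q]
    {M : Matrix q q K} :
    M.charpolyRev.natDegree = M.rank ↔ Disjoint (ker M.mulVecLin) (range M.mulVecLin) := by
  have hle : ker M.mulVecLin ≤ End.maxGenEigenspace M.mulVecLin 0 := fun x hx =>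
    (End.mem_maxGenEigenspace _ _ _).2 ⟨1, by simpa using hx⟩
  have hdeg : M.charpolyRev.natDegree =
      Fintype.card q - finrank K (End.maxGenEigenspace M.mulVecLin 0) := by
    rw [← reverse_charpoly, Polynomial.reverse_natDegree, finrank_maxGenEigenspace_zero_eq,
      charpoly_mulVecLin, charpoly_natDegree_eq_dim]
  have hcard := Submodule.finrank_le (End.maxGenEigenspace M.mulVecLin 0)
  have hrank := finrank_range_add_finrank_ker M.mulVecLin
  rw [finrank_fintype_fun_eq_card] at hcard hrank
  rw [← maxGenEigenspace_zero_eq_ker_iff, hdeg, Matrix.rank]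
  refine ⟨fun h => (Submodule.eq_of_le_of_finrank_eq hle ?_).symm, fun h => ?_⟩
  · omega
  · rw [h]
    omega

variable {n : ℕ} {E A : Matrix (Fin n) (Fin n) ℂ}

theorem charPoly_eq_C_mul_charpolyRev (hA : IsUnit A.det) :
    charPoly E A = Polynomial.C (-A).det * (A⁻¹ * E).charpolyRev := by
  have hAE : A.map Polynomial.C * (A⁻¹ * E).map Polynomial.C = E.map Polynomial.C := by
    rw [← Matrix.map_mul, mul_nonsing_inv_cancel_left _ _ hA]
  rw [charPoly, charpolyRev, RingHom.map_det, ← det_mul, RingHom.mapMatrix_apply]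
  congr 1
  rw [Matrix.map_neg _ (map_neg _), Matrix.mul_sub, mul_one, Matrix.mul_smul, Matrix.neg_mul, hAE,
    smul_neg]
  abel

theorem isImpulseFree_iff (hA : IsUnit A.det) :
    IsImpulseFree E A ↔ ∀ x, E *ᵥ x = 0 → A *ᵥ x ∈ range E.mulVecLin → x = 0 := by
  have hrev : (A⁻¹ * E).charpolyRev ≠ 0 := fun h => by
    simpa [h] using (A⁻¹ * E).eval_charpolyRev
  have hdet : (-A).det ≠ 0 := by
    rw [det_neg]
    exact mul_ne_zero (pow_ne_zero _ (neg_ne_zero.2 one_ne_zero)) hA.ne_zero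
  have hinj := mulVec_injective_of_det_ne_zero (isUnit_nonsing_inv_det A hA).ne_zero
  have hker (x) : x ∈ ker (A⁻¹ * E).mulVecLin ↔ E *ᵥ x = 0 := by
    rw [mem_ker, mulVecLin_apply, ← mulVec_mulVec, ← hinj.eq_iff (a := E *ᵥ x), mulVec_zero]
  have hrange (x) : x ∈ range (A⁻¹ * E).mulVecLin ↔ A *ᵥ x ∈ range E.mulVecLin := by
    refine exists_congr fun z => ?_
    rw [mulVecLin_apply, mulVecLin_apply, ← mulVec_mulVec, ← hinj.eq_iff (b := A *ᵥ x),
      mulVec_mulVec x, nonsing_inv_mul A hA, one_mulVec]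
  rw [IsImpulseFree, charPoly_eq_C_mul_charpolyRev hA, Polynomial.degree_C_mul hdet,
    Polynomial.degree_eq_natDegree hrev, Nat.cast_inj, ← rank_mul_eq_right_of_isUnit_det A⁻¹ E
    (isUnit_nonsing_inv_det A hA), natDegree_charpolyRev_eq_rank_iff, Submodule.disjoint_def]
  simp only [hker, hrange]

end ImpulseFree

section NullBases

variable {p q : Type*} [Fintype p] [Fintype q] {k : ℕ}

theorem IsRightNullBasis.range_eq {M : Matrix p q ℂ} {S : Matrix q (Fin k) ℂ}
    (h : IsRightNullBasis M S) : range S.mulVecLin = ker M.mulVecLin := by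
  ext x
  simp only [mem_range, mem_ker, mulVecLin_apply, h.2, eq_comm]

theorem IsRightNullBasis.ker_eq_bot {M : Matrix p q ℂ} {S : Matrix q (Fin k) ℂ}
    (h : IsRightNullBasis M S) : ker S.mulVecLin = ⊥ := by
  rw [← ker_mulVecLin_conjTranspose_mul_self, h.1, mulVecLin_one]
  exact ker_id

theorem IsLeftNullBasis.isRightNullBasis {M : Matrix p q ℂ} {T : Matrix p (Fin k) ℂ}
    (h : IsLeftNullBasis M T) : IsRightNullBasis Mᴴ T := by
  refine ⟨h.1, fun y => ?_⟩
  rw [← h.2, mulVec_conjTranspose, star_eq_zero]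

theorem IsLeftNullBasis.ker_conjTranspose {M : Matrix p q ℂ} {T : Matrix p (Fin k) ℂ}
    (h : IsLeftNullBasis M T) : ker Tᴴ.mulVecLin = range M.mulVecLin := by
  refine (Submodule.eq_of_le_of_finrank_eq ?_ ?_).symm
  · rintro _ ⟨x, rfl⟩
    have horth (y : Fin k → ℂ) : star (T *ᵥ y) ᵥ* M = 0 := (h.2 _).2 ⟨y, rfl⟩
    rw [mem_ker, mulVecLin_apply, mulVecLin_apply, ← dotProduct_star_self_eq_zero (R := ℂ),
      dotProduct_mulVec, dotProduct_mulVec, ← star_mulVec, horth, zero_dotProduct]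
  · have hrankT := finrank_range_add_finrank_ker Tᴴ.mulVecLin
    have hrankM := finrank_range_add_finrank_ker Mᴴ.mulVecLin
    have hT : T.rank = finrank ℂ (ker Mᴴ.mulVecLin) := by
      rw [Matrix.rank, h.isRightNullBasis.range_eq]
    rw [finrank_fintype_fun_eq_card, ← Matrix.rank, rank_conjTranspose] at hrankT hrankM
    rw [← Matrix.rank]
    omega

variable {n m l : ℕ} {E A : Matrix (Fin n) (Fin n) ℂ} {B : Matrix (Fin n) (Fin m) ℂ}
  {C : Matrix (Fin m) (Fin n) ℂ} {Ta : Matrix (Fin n) (Fin k) ℂ} {Sb : Matrix (Fin n) (Fin l) ℂ}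

theorem IsTa.ker_conjTranspose (hTa : IsTa E C Ta) :
    ker Taᴴ.mulVecLin = (ker C.mulVecLin).map E.mulVecLin := by
  obtain ⟨_, S, hS, hT⟩ := hTa
  rw [hT.ker_conjTranspose, range_mulVecLin_mul, hS.range_eq]

theorem IsSb.range_eq (hSb : IsSb E A B C Sb) :
    range Sb.mulVecLin = ker E.mulVecLin ⊓ (ker C.mulVecLin ⊓
      (range E.mulVecLin ⊔ range B.mulVecLin).comap A.mulVecLin) := by
  obtain ⟨_, T, hT, hS⟩ := hSb
  rw [hS.range_eq, ker_mulVecLin_fromRows, ker_mulVecLin_fromRows, mulVecLin_mul, ker_comp,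
    hT.ker_conjTranspose, range_mulVecLin_fromCols, inf_comm (ker C.mulVecLin)]

theorem IsSb.ker_eq_bot (hSb : IsSb E A B C Sb) : ker Sb.mulVecLin = ⊥ :=
  let ⟨_, _, _, hS⟩ := hSb
  hS.ker_eq_bot

theorem rank_conjTranspose_mul_mul_eq_iff (hTa : IsTa E C Ta) (hSb : IsSb E A B C Sb) :
    (Taᴴ * A * Sb).rank = l ↔
      ∀ x, E *ᵥ x = 0 → C *ᵥ x = 0 → A *ᵥ x ∈ (ker C.mulVecLin).map E.mulVecLin → x = 0 := by
  have hker (c : Fin l → ℂ) : c ∈ ker (Taᴴ * A * Sb).mulVecLin ↔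
      A *ᵥ Sb *ᵥ c ∈ (ker C.mulVecLin).map E.mulVecLin := by
    rw [← hTa.ker_conjTranspose, mem_ker, mem_ker, mulVecLin_apply, mulVecLin_apply,
      mulVec_mulVec, mulVec_mulVec, Matrix.mul_assoc]
  have hcard := rank_eq_card_iff (A := Taᴴ * A * Sb)
  rw [Fintype.card_fin] at hcard
  rw [hcard, Submodule.eq_bot_iff]
  constructor
  · intro h x hE hC hA
    have hx : x ∈ range Sb.mulVecLin :=
      hSb.range_eq ▸ ⟨hE, hC, Submodule.mem_sup_left (map_le_range hA)⟩
    obtain ⟨c, rfl⟩ := hx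
    rw [h c ((hker c).2 hA), map_zero]
  · intro h c hc
    obtain ⟨hE, hC, -⟩ := hSb.range_eq ▸ mem_range_self Sb.mulVecLin c
    exact hSb.ker_eq_bot.le (h _ hE hC ((hker c).1 hc))

theorem IsSb.finrank_map (hSb : IsSb E A B C Sb)
    (hAC : ∀ x, A *ᵥ x = 0 → C *ᵥ x = 0 → x = 0) :
    finrank ℂ ((range Sb.mulVecLin).map A.mulVecLin) = l := by
  have hcard := rank_eq_card_iff (A := A * Sb)
  rw [Fintype.card_fin] at hcard
  rw [← range_mulVecLin_mul, ← Matrix.rank, hcard, Submodule.eq_bot_iff]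
  intro c hc
  rw [mem_ker, mulVecLin_apply, ← mulVec_mulVec] at hc
  obtain ⟨-, hC, -⟩ := hSb.range_eq ▸ mem_range_self Sb.mulVecLin c
  exact hSb.ker_eq_bot.le (hAC _ hc hC)

end NullBases

section Stability

variable {n : ℕ} {E A : Matrix (Fin n) (Fin n) ℂ}

theorem IsAsymptoticallyStable.isUnit_det_sub (h : IsAsymptoticallyStable E A) {s : ℂ}
    (hs : 0 ≤ s.re) : IsUnit (s • E - A).det :=
  isUnit_iff_ne_zero.2 fun hdet => (h hdet).not_ge hs

theorem IsAsymptoticallyStable.isUnit_det (h : IsAsymptoticallyStable E A) : IsUnit A.det := by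
  have hdet := h.isUnit_det_sub (s := 0) le_rfl
  rw [zero_smul, zero_sub, det_neg] at hdet
  exact isUnit_of_mul_isUnit_right hdet

theorem IsAsymptoticallyStable.isRegular (h : IsAsymptoticallyStable E A) : IsRegular E A :=
  ⟨0, (h.isUnit_det_sub (s := 0) le_rfl).ne_zero⟩

end Stability

section Necessity

variable {n m k l : ℕ} {E A : Matrix (Fin n) (Fin n) ℂ} {B : Matrix (Fin n) (Fin m) ℂ}
  {C : Matrix (Fin m) (Fin n) ℂ} {F K : Matrix (Fin m) (Fin m) ℂ}
  {Ta : Matrix (Fin n) (Fin k) ℂ} {Sb : Matrix (Fin n) (Fin l) ℂ}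

theorem rank_eq_of_isImpulseFree (hTa : IsTa E C Ta) (hSb : IsSb E A B C Sb)
    (hA : IsUnit (A - B * K * C).det) (himp : IsImpulseFree (E + B * F * C) (A - B * K * C)) :
    (Taᴴ * A * Sb).rank = l := by
  rw [rank_conjTranspose_mul_mul_eq_iff hTa hSb]
  rintro x hEx hCx ⟨z, hCz, hz⟩
  replace hCz : C *ᵥ z = 0 := hCz
  refine (isImpulseFree_iff hA).1 himp x ?_ ⟨z, ?_⟩
  · rwa [add_mul_mulVec_of_mulVec_eq_zero hCx]
  · rw [mulVecLin_apply, add_mul_mulVec_of_mulVec_eq_zero hCz,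
      sub_mul_mulVec_of_mulVec_eq_zero hCx]
    exact hz

theorem rank_add_le_of_isImpulseFree (hSb : IsSb E A B C Sb) (hA : IsUnit (A - B * K * C).det)
    (himp : IsImpulseFree (E + B * F * C) (A - B * K * C)) :
    (E + B * F * C).rank + l ≤ (fromCols E B).rank := by
  have hAC (x) (hAx : A *ᵥ x = 0) (hCx : C *ᵥ x = 0) : x = 0 :=
    eq_zero_of_mulVec_eq_zero hA.ne_zero (by rwa [sub_mul_mulVec_of_mulVec_eq_zero hCx])
  have hdisj : Disjoint (range (E + B * F * C).mulVecLin)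
      ((range Sb.mulVecLin).map A.mulVecLin) := by
    rw [Submodule.disjoint_def]
    rintro _ hx' ⟨x, hx, rfl⟩
    obtain ⟨hEx, hCx, -⟩ := hSb.range_eq ▸ hx
    replace hCx : C *ᵥ x = 0 := hCx
    have hx0 : x = 0 := by
      refine (isImpulseFree_iff hA).1 himp x ?_ ?_
      · rwa [add_mul_mulVec_of_mulVec_eq_zero hCx]
      · rwa [sub_mul_mulVec_of_mulVec_eq_zero hCx]
    rw [hx0, map_zero]
  rw [← rank_fromCols_add_mul E B (F * C), ← Matrix.mul_assoc, Matrix.rank, Matrix.rank,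
    range_mulVecLin_fromCols, ← hSb.finrank_map hAC, ← finrank_sup_of_disjoint hdisj]
  refine Submodule.finrank_mono (sup_le le_sup_left ?_)
  rintro _ ⟨x, hx, rfl⟩
  obtain ⟨-, -, hAx⟩ := hSb.range_eq ▸ hx
  rwa [Matrix.mul_assoc, range_mulVecLin_add_mul_sup]

theorem solvabilityConditions_of_feedback (hTa : IsTa E C Ta) (hSb : IsSb E A B C Sb)
    (himp : IsImpulseFree (E + B * F * C) (A - B * K * C))
    (hstab : IsAsymptoticallyStable (E + B * F * C) (A - B * K * C)) :
    SolvabilityConditions E A B C Ta Sb (E + B * F * C).rank := by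
  have hrank := rank_eq_of_isImpulseFree hTa hSb hstab.isUnit_det himp
  have hupp := rank_add_le_of_isImpulseFree hSb hstab.isUnit_det himp
  have hlow : (fromCols E B).rank ≤ (E + B * F * C).rank + B.rank := by
    rw [← rank_fromCols_add_mul E B (F * C), ← Matrix.mul_assoc]
    exact rank_fromCols_le _ _
  refine ⟨hrank, fun s hs => ?_, by omega, by omega⟩
  have hdet := hstab.isUnit_det_sub hs.ge
  have hpencil : s • (E + B * F * C) - (A - B * K * C) = (s • E - A) + B * (s • F + K) * C := by
    rw [smul_add, Matrix.mul_add, Matrix.add_mul, Matrix.mul_smul, Matrix.smul_mul]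
    abel
  rw [hpencil] at hdet
  have hrows := rank_fromRows_eq_card_of_isUnit_det hdet
  rw [Matrix.mul_assoc] at hdet
  have hcols := rank_fromCols_eq_card_of_isUnit_det hdet
  rw [Fintype.card_fin] at hrows hcols
  exact ⟨hcols, hrows⟩

end Necessity

section PortHamiltonian

theorem star_mulVec_dotProduct_mulVec {R p q t : Type*} [NonUnitalSemiring R] [StarRing R]
    [Fintype p] [Fintype q] [Fintype t] (Q : Matrix p q R) (A : Matrix p t R) (x : q → R)
    (y : t → R) : star (Q *ᵥ x) ⬝ᵥ A *ᵥ y = star x ⬝ᵥ (Qᴴ * A) *ᵥ y := by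
  rw [star_mulVec, ← dotProduct_mulVec, mulVec_mulVec]

variable {n m : ℕ} {Q E A : Matrix (Fin n) (Fin n) ℂ} {B : Matrix (Fin n) (Fin m) ℂ}
  {C : Matrix (Fin m) (Fin n) ℂ} {F K : Matrix (Fin m) (Fin m) ℂ} {x : Fin n → ℂ}

/-- Twice the dissipation matrix `Qᴴ * R * Q` of a port-Hamiltonian system with `A = (J - R) * Q`,
expressed through `Q` and `A` alone because `J` and `R` are not determined by the system. -/
def dissipation (Q A : Matrix (Fin n) (Fin n) ℂ) : Matrix (Fin n) (Fin n) ℂ :=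
  -(Qᴴ * A + Aᴴ * Q)

theorem dissipation_sub_mul {J R : Matrix (Fin n) (Fin n) ℂ}
    (hJ : Qᴴ * J * Q = -(Qᴴ * J * Q)ᴴ) (hR : (Qᴴ * R * Q).IsHermitian) :
    dissipation Q ((J - R) * Q) = Qᴴ * R * Q + Qᴴ * R * Q := by
  have hQA : Qᴴ * ((J - R) * Q) = Qᴴ * J * Q - Qᴴ * R * Q := by
    rw [Matrix.sub_mul, Matrix.mul_sub, Matrix.mul_assoc, Matrix.mul_assoc]
  have hAQ : ((J - R) * Q)ᴴ * Q = -(Qᴴ * J * Q) - Qᴴ * R * Q := by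
    rw [← conjTranspose_conjTranspose Q, ← conjTranspose_mul, conjTranspose_conjTranspose, hQA,
      conjTranspose_sub, hR.eq, ← neg_eq_iff_eq_neg.2 hJ]
  rw [dissipation, hQA, hAQ]
  abel

theorem isPortHamiltonianWith_of_posSemidef {X : Matrix (Fin n) (Fin n) ℂ} (hC : C = Bᴴ * Q)
    (hE : (Qᴴ * E).PosSemidef) (hA : (dissipation Q (X * Q)).PosSemidef) :
    IsPortHamiltonianWith Q E (X * Q) B C := by
  refine ⟨(1 / 2 : ℂ) • (X - Xᴴ), (-(1 / 2) : ℂ) • (X + Xᴴ), B, 0, ?_, (sub_zero B).symm,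
    by rw [add_zero, hC], ?_, hE, ?_, ?_, Matrix.mul_zero _⟩
  · congr 1
    module
  · simpa only [conjTranspose_mul, conjTranspose_conjTranspose] using hE.1.eq.symm
  · have hskew : ((1 / 2 : ℂ) • (X - Xᴴ))ᴴ = -((1 / 2 : ℂ) • (X - Xᴴ)) := by
      rw [conjTranspose_smul, conjTranspose_sub, conjTranspose_conjTranspose, ← smul_neg, neg_sub]
      simp
    rw [conjTranspose_mul, conjTranspose_mul, conjTranspose_conjTranspose, hskew,
      ← Matrix.mul_assoc, Matrix.mul_neg, Matrix.neg_mul, neg_neg]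
  · have hR : Qᴴ * ((-(1 / 2) : ℂ) • (X + Xᴴ)) * Q = (1 / 2 : ℂ) • dissipation Q (X * Q) := by
      rw [dissipation, conjTranspose_mul, Matrix.mul_smul, Matrix.smul_mul, Matrix.mul_add,
        Matrix.add_mul, Matrix.mul_assoc Qᴴ X Q, smul_neg, neg_smul]
    rw [hR]
    exact hA.smul (by norm_num [Complex.le_def])

theorem isPortHamiltonianWith_iff : IsPortHamiltonianWith Q E A B C ↔
    (∃ X, A = X * Q) ∧ C = Bᴴ * Q ∧ (Qᴴ * E).PosSemidef ∧ (dissipation Q A).PosSemidef := by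
  constructor
  · rintro ⟨J, R, G, P, rfl, rfl, rfl, -, hE, hJ, hR, hP⟩
    have hPQ : Pᴴ * Q = 0 := by simpa using congrArg conjTranspose hP
    refine ⟨⟨_, rfl⟩, ?_, hE, dissipation_sub_mul hJ hR.1 ▸ hR.add hR⟩
    rw [conjTranspose_add, conjTranspose_sub, Matrix.add_mul, Matrix.sub_mul, hPQ, add_zero,
      sub_zero]
  · rintro ⟨⟨X, rfl⟩, hC, hE, hA⟩
    exact isPortHamiltonianWith_of_posSemidef hC hE hA

theorem IsPortHamiltonianWith.isUnit_det (h : IsPortHamiltonianWith Q E A B C)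
    (hAC : ∀ x, A *ᵥ x = 0 → C *ᵥ x = 0 → x = 0) : IsUnit Q.det := by
  obtain ⟨⟨X, rfl⟩, rfl, -, -⟩ := isPortHamiltonianWith_iff.1 h
  rw [isUnit_iff_ne_zero]
  intro hdet
  obtain ⟨v, hv, hQv⟩ := exists_mulVec_eq_zero_iff.2 hdet
  exact hv <| hAC v (by rw [← mulVec_mulVec, hQv, mulVec_zero])
    (by rw [← mulVec_mulVec, hQv, mulVec_zero])

theorem star_dotProduct_dissipation_mulVec (Q A : Matrix (Fin n) (Fin n) ℂ) (x : Fin n → ℂ) :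
    star x ⬝ᵥ dissipation Q A *ᵥ x = ((-(2 * (star (Q *ᵥ x) ⬝ᵥ A *ᵥ x).re) : ℝ) : ℂ) := by
  rw [dissipation, neg_mulVec, add_mulVec, dotProduct_neg, dotProduct_add,
    ← star_mulVec_dotProduct_mulVec, ← star_mulVec_dotProduct_mulVec, star_dotProduct (A *ᵥ x),
    Complex.star_def, Complex.add_conj, Complex.ofReal_neg]

theorem dissipation_mulVec_eq_zero_iff (hA : (dissipation Q A).PosSemidef) :
    dissipation Q A *ᵥ x = 0 ↔ 0 ≤ (star (Q *ᵥ x) ⬝ᵥ A *ᵥ x).re := by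
  have hnonneg := hA.dotProduct_mulVec_nonneg x
  rw [← hA.dotProduct_mulVec_zero_iff]
  rw [star_dotProduct_dissipation_mulVec] at hnonneg ⊢
  norm_cast at hnonneg ⊢
  constructor <;> intro h <;> linarith

theorem dissipation_mulVec_eq_zero_of_impulse (hE : (Qᴴ * E).PosSemidef)
    (hA : (dissipation Q A).PosSemidef) (hEx : E *ᵥ x = 0) (hAx : A *ᵥ x ∈ range E.mulVecLin) :
    dissipation Q A *ᵥ x = 0 := by
  obtain ⟨z, hz⟩ := hAx
  rw [mulVecLin_apply] at hz
  have hpower : star (Q *ᵥ x) ⬝ᵥ E *ᵥ z = 0 := by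
    rw [star_mulVec_dotProduct_mulVec, dotProduct_mulVec, ← hE.1.eq, ← star_mulVec,
      ← mulVec_mulVec, hEx, mulVec_zero, star_zero, zero_dotProduct]
  rw [dissipation_mulVec_eq_zero_iff hA, ← hz, hpower, Complex.zero_re]

theorem isAsymptoticallyStable_of_dissipation (hQ : IsUnit Q.det) (hE : (Qᴴ * E).PosSemidef)
    (hA : (dissipation Q A).PosSemidef)
    (hdamped : ∀ s : ℂ, s.re = 0 → ∀ x, A *ᵥ x = s • E *ᵥ x → dissipation Q A *ᵥ x = 0 → x = 0) :
    IsAsymptoticallyStable E A := by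
  intro s hs
  by_contra hneg
  have hre : 0 ≤ s.re := not_lt.1 hneg
  obtain ⟨x, hx, hsx⟩ := exists_mulVec_eq_zero_iff.2 hs
  rw [sub_mulVec, smul_mulVec, sub_eq_zero, eq_comm] at hsx
  obtain ⟨hre_nonneg, him⟩ := Complex.le_def.1 (hE.dotProduct_mulVec_nonneg x)
  have hpower : (star (Q *ᵥ x) ⬝ᵥ A *ᵥ x).re = s.re * (star x ⬝ᵥ (Qᴴ * E) *ᵥ x).re := by
    rw [hsx, dotProduct_smul, star_mulVec_dotProduct_mulVec, smul_eq_mul, Complex.mul_re, ← him,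
      Complex.zero_im, mul_zero, sub_zero]
  have hWx : dissipation Q A *ᵥ x = 0 :=
    (dissipation_mulVec_eq_zero_iff hA).2 (hpower ▸ mul_nonneg hre hre_nonneg)
  have hpower_zero : (star (Q *ᵥ x) ⬝ᵥ A *ᵥ x).re = 0 := by
    have := star_dotProduct_dissipation_mulVec Q A x
    rw [hWx, dotProduct_zero] at this
    norm_cast at this
    linarith
  rcases mul_eq_zero.1 (hpower.symm.trans hpower_zero) with hs0 | hEx
  · exact hx (hdamped s hs0 x hsx hWx)
  · have hQEx : Qᴴ *ᵥ E *ᵥ x = 0 := by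
      rw [mulVec_mulVec]
      exact (hE.dotProduct_mulVec_zero_iff x).1 (Complex.ext hEx him.symm)
    have hEx0 : E *ᵥ x = 0 :=
      eq_zero_of_mulVec_eq_zero (by rw [det_conjTranspose]; exact hQ.star.ne_zero) hQEx
    rw [hEx0, smul_zero] at hsx
    exact hx (hdamped 0 rfl x (by rw [hsx, zero_smul]) hWx)

theorem dissipation_feedback (hC : C = Bᴴ * Q) :
    dissipation Q (A - B * K * C) = dissipation Q A + Cᴴ * (K + Kᴴ) * C := by
  have hCH : Cᴴ = Qᴴ * B := by rw [hC, conjTranspose_mul, conjTranspose_conjTranspose]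
  have hBQ : (B * K * C)ᴴ * Q = Cᴴ * Kᴴ * C := by
    rw [conjTranspose_mul, conjTranspose_mul, Matrix.mul_assoc, Matrix.mul_assoc Kᴴ, ← hC,
      Matrix.mul_assoc]
  have hQB : Qᴴ * (B * K * C) = Cᴴ * K * C := by
    rw [hCH, ← Matrix.mul_assoc, ← Matrix.mul_assoc]
  rw [dissipation, dissipation, conjTranspose_sub, Matrix.sub_mul, Matrix.mul_sub, hBQ, hQB,
    Matrix.mul_add, Matrix.add_mul]
  abel

theorem IsPortHamiltonianWith.feedback (h : IsPortHamiltonianWith Q E A B C)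
    (hE : (Qᴴ * (E + B * F * C)).PosSemidef) (hK : (K + Kᴴ).PosSemidef) :
    IsPortHamiltonianWith Q (E + B * F * C) (A - B * K * C) B C := by
  obtain ⟨⟨X, rfl⟩, hC, -, hA⟩ := isPortHamiltonianWith_iff.1 h
  refine isPortHamiltonianWith_iff.2 ⟨⟨X - B * K * Bᴴ, ?_⟩, hC, hE, ?_⟩
  · rw [Matrix.sub_mul, Matrix.mul_assoc _ Bᴴ, ← hC]
  · rw [dissipation_feedback hC]
    exact hA.add (hK.conjTranspose_mul_mul_same C)

theorem mulVec_eq_zero_of_dissipation_feedback (h : IsPortHamiltonianWith Q E A B C)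
    (hK : (K + Kᴴ).PosDef) (hx : dissipation Q (A - B * K * C) *ᵥ x = 0) : C *ᵥ x = 0 := by
  obtain ⟨-, hC, -, hA⟩ := isPortHamiltonianWith_iff.1 h
  have hquad : star x ⬝ᵥ dissipation Q A *ᵥ x + star (C *ᵥ x) ⬝ᵥ (K + Kᴴ) *ᵥ C *ᵥ x = 0 := by
    rw [mulVec_mulVec, star_mulVec_dotProduct_mulVec, ← Matrix.mul_assoc, ← dotProduct_add,
      ← add_mulVec, ← dissipation_feedback hC, hx, dotProduct_zero]
  by_contra hCx
  exact (add_pos_of_nonneg_of_pos (hA.dotProduct_mulVec_nonneg x)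
    (hK.dotProduct_mulVec_pos hCx)).ne' hquad

end PortHamiltonian

section Sufficiency

variable {n m k l : ℕ} {Q E A : Matrix (Fin n) (Fin n) ℂ} {B : Matrix (Fin n) (Fin m) ℂ}
  {C : Matrix (Fin m) (Fin n) ℂ} {F K : Matrix (Fin m) (Fin m) ℂ}
  {Ta : Matrix (Fin n) (Fin k) ℂ} {Sb : Matrix (Fin n) (Fin l) ℂ}

theorem eq_zero_of_rank_fromRows_eq {s : ℂ} {x : Fin n → ℂ}
    (hrank : (fromRows (s • E - A) C).rank = n) (hAx : A *ᵥ x = s • E *ᵥ x) (hCx : C *ᵥ x = 0) :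
    x = 0 := by
  have hker := rank_eq_card_iff.1 (hrank.trans (Fintype.card_fin n).symm)
  rw [ker_mulVecLin_fromRows] at hker
  refine hker.le ⟨?_, hCx⟩
  rw [SetLike.mem_coe, mem_ker, mulVecLin_apply, sub_mulVec, smul_mulVec, hAx, sub_self]

theorem exists_feedback_rank_eq_disjoint (hQ : IsUnit Q.det) (hC : C = Bᴴ * Q)
    (hE : (Qᴴ * E).PosSemidef) {L : Submodule ℂ (Fin n → ℂ)}
    (hL : Disjoint ((ker C.mulVecLin).map E.mulVecLin) L) {r : ℕ}
    (hlow : (fromCols E B).rank ≤ r + B.rank)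
    (hupp : r + finrank ℂ L ≤ (fromCols E B).rank) :
    ∃ F : Matrix (Fin m) (Fin m) ℂ, (Qᴴ * (E + B * F * C)).PosSemidef ∧
      (E + B * F * C).rank = r ∧ Disjoint (range (E + B * F * C).mulVecLin) L := by
  have hQH : IsUnit Qᴴ.det := by
    rw [det_conjTranspose]
    exact hQ.star
  have hinj : Function.Injective Qᴴ.mulVecLin := mulVec_injective_of_det_ne_zero hQH.ne_zero
  have hCH : Cᴴ = Qᴴ * B := by rw [hC, conjTranspose_mul, conjTranspose_conjTranspose]
  have hcols : (fromCols (Qᴴ * E) Cᴴ).rank = (fromCols E B).rank := by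
    rw [hCH, ← mul_fromCols, rank_mul_eq_right_of_isUnit_det _ _ hQH]
  have hCrank : Cᴴ.rank = B.rank := by rw [hCH, rank_mul_eq_right_of_isUnit_det _ _ hQH]
  have hLrank : finrank ℂ (L.map Qᴴ.mulVecLin) = finrank ℂ L :=
    (L.equivMapOfInjective _ hinj).finrank_eq.symm
  obtain ⟨F, hpos, hrank, hdisj⟩ := exists_posSemidef_rank_eq_disjoint hE C
    (L := L.map Qᴴ.mulVecLin) (r := r)
    (by rw [mulVecLin_mul, Submodule.map_comp]; exact Submodule.disjoint_map hinj hL)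
    (by rwa [hcols, hCrank]) (by rwa [hcols, hLrank])
  have hQF : Qᴴ * E + Cᴴ * F * C = Qᴴ * (E + B * F * C) := by
    rw [hCH, Matrix.mul_add, Matrix.mul_assoc, Matrix.mul_assoc, Matrix.mul_assoc]
  rw [hQF] at hpos hrank hdisj
  rw [rank_mul_eq_right_of_isUnit_det _ _ hQH] at hrank
  rw [range_mulVecLin_mul, Submodule.disjoint_def] at hdisj
  refine ⟨F, hpos, hrank, Submodule.disjoint_def.2 fun v hv hvL => hinj ?_⟩
  rw [map_zero]
  exact hdisj _ (Submodule.mem_map_of_mem hv) (Submodule.mem_map_of_mem hvL)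

theorem isAsymptoticallyStable_feedback (h : IsPortHamiltonianWith Q E A B C)
    (hobs : ∀ s : ℂ, s.re = 0 → (fromRows (s • E - A) C).rank = n) (hQ : IsUnit Q.det)
    (hE : (Qᴴ * (E + B * F * C)).PosSemidef) (hK : (K + Kᴴ).PosDef) :
    IsAsymptoticallyStable (E + B * F * C) (A - B * K * C) := by
  obtain ⟨-, -, -, hA⟩ := isPortHamiltonianWith_iff.1 (h.feedback hE hK.posSemidef)
  refine isAsymptoticallyStable_of_dissipation hQ hE hA fun s hs x hsx hWx => ?_
  have hCx := mulVec_eq_zero_of_dissipation_feedback h hK hWx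
  rw [sub_mul_mulVec_of_mulVec_eq_zero hCx, add_mul_mulVec_of_mulVec_eq_zero hCx] at hsx
  exact eq_zero_of_rank_fromRows_eq (hobs s hs) hsx hCx

theorem isImpulseFree_feedback (h : IsPortHamiltonianWith Q E A B C) (hSb : IsSb E A B C Sb)
    (hE : (Qᴴ * (E + B * F * C)).PosSemidef) (hK : (K + Kᴴ).PosDef)
    (hdisj : Disjoint (range (E + B * F * C).mulVecLin) ((range Sb.mulVecLin).map A.mulVecLin))
    (hdet : IsUnit (A - B * K * C).det) : IsImpulseFree (E + B * F * C) (A - B * K * C) := by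
  obtain ⟨-, -, -, hA⟩ := isPortHamiltonianWith_iff.1 (h.feedback hE hK.posSemidef)
  rw [isImpulseFree_iff hdet]
  intro x hEx hAx
  have hCx := mulVec_eq_zero_of_dissipation_feedback h hK
    (dissipation_mulVec_eq_zero_of_impulse hE hA hEx hAx)
  refine eq_zero_of_mulVec_eq_zero hdet.ne_zero ?_
  rw [add_mul_mulVec_of_mulVec_eq_zero hCx] at hEx
  rw [sub_mul_mulVec_of_mulVec_eq_zero hCx] at hAx ⊢
  have hx : x ∈ range Sb.mulVecLin := by
    rw [hSb.range_eq]
    refine ⟨hEx, hCx, ?_⟩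
    rw [← range_mulVecLin_add_mul_sup E B (F * C), ← Matrix.mul_assoc]
    exact Submodule.mem_sup_left hAx
  exact Submodule.disjoint_def.1 hdisj _ hAx (Submodule.mem_map_of_mem hx)

theorem exists_feedback (h : IsPortHamiltonianWith Q E A B C) (hTa : IsTa E C Ta)
    (hSb : IsSb E A B C Sb) {r : ℤ} (hcond : SolvabilityConditions E A B C Ta Sb r) :
    ∃ K F : Matrix (Fin m) (Fin m) ℂ,
      IsRegular (E + B * F * C) (A - B * K * C) ∧
      IsImpulseFree (E + B * F * C) (A - B * K * C) ∧
      IsAsymptoticallyStable (E + B * F * C) (A - B * K * C) ∧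
      ((E + B * F * C).rank : ℤ) = r ∧
      IsPortHamiltonianWith Q (E + B * F * C) (A - B * K * C) B C := by
  obtain ⟨hrank, hpencil, hlow, hupp⟩ := hcond
  have hobs (s : ℂ) (hs : s.re = 0) := (hpencil s hs).2
  have hAC (x) (hAx : A *ᵥ x = 0) : C *ᵥ x = 0 → x = 0 :=
    eq_zero_of_rank_fromRows_eq (hobs 0 rfl) (hAx.trans (zero_smul ℂ _).symm)
  have hQ := h.isUnit_det hAC
  obtain ⟨-, hC, hE, -⟩ := isPortHamiltonianWith_iff.1 h
  have hL : Disjoint ((ker C.mulVecLin).map E.mulVecLin)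
      ((range Sb.mulVecLin).map A.mulVecLin) := by
    rw [Submodule.disjoint_def]
    rintro _ hAx ⟨x, hx, rfl⟩
    obtain ⟨hEx, hCx, -⟩ := hSb.range_eq ▸ hx
    rw [(rank_conjTranspose_mul_mul_eq_iff hTa hSb).1 hrank x hEx hCx hAx, map_zero]
  have hB : B.rank ≤ (fromCols E B).rank := by
    rw [Matrix.rank, Matrix.rank, range_mulVecLin_fromCols]
    exact Submodule.finrank_mono le_sup_right
  lift r to ℕ using by omega
  obtain ⟨F, hF, hFr, hdisj⟩ := exists_feedback_rank_eq_disjoint hQ hC hE hL (r := r)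
    (by omega) (by rw [hSb.finrank_map hAC]; omega)
  have hK : ((1 : Matrix (Fin m) (Fin m) ℂ) + 1ᴴ).PosDef := by
    rw [conjTranspose_one]
    exact PosDef.one.add PosDef.one
  have hstab := isAsymptoticallyStable_feedback h hobs hQ hF hK
  exact ⟨1, F, hstab.isRegular, isImpulseFree_feedback h hSb hF hK hdisj hstab.isUnit_det, hstab,
    congrArg _ hFr, h.feedback hF hK.posSemidef⟩

end Sufficiency

end DescriptorSystem

theorem mainTheorem3 {n m k l : ℕ} (E A : Matrix (Fin n) (Fin n) ℂ)
    (B : Matrix (Fin n) (Fin m) ℂ) (C : Matrix (Fin m) (Fin n) ℂ)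
    (hpH : DescriptorSystem.IsPortHamiltonian E A B C)
    (Ta : Matrix (Fin n) (Fin k) ℂ) (hTa : DescriptorSystem.IsTa E C Ta)
    (Sb : Matrix (Fin n) (Fin l) ℂ) (hSb : DescriptorSystem.IsSb E A B C Sb)
    (r : ℤ) :
    ((∃ K F : Matrix (Fin m) (Fin m) ℂ,
        DescriptorSystem.IsRegular (E + B * F * C) (A - B * K * C) ∧
        DescriptorSystem.IsImpulseFree (E + B * F * C) (A - B * K * C) ∧
        DescriptorSystem.IsAsymptoticallyStable (E + B * F * C) (A - B * K * C) ∧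
        ((E + B * F * C).rank : ℤ) = r ∧
        DescriptorSystem.IsPortHamiltonian (E + B * F * C) (A - B * K * C) B C) ↔
      DescriptorSystem.SolvabilityConditions E A B C Ta Sb r) ∧
    -- the same with the structure matrix `Q` of the given system kept in the closed loop
    (∀ Q : Matrix (Fin n) (Fin n) ℂ, DescriptorSystem.IsPortHamiltonianWith Q E A B C →
      ((∃ K F : Matrix (Fin m) (Fin m) ℂ,
          DescriptorSystem.IsRegular (E + B * F * C) (A - B * K * C) ∧
          DescriptorSystem.IsImpulseFree (E + B * F * C) (A - B * K * C) ∧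
          DescriptorSystem.IsAsymptoticallyStable (E + B * F * C) (A - B * K * C) ∧
          ((E + B * F * C).rank : ℤ) = r ∧
          DescriptorSystem.IsPortHamiltonianWith Q (E + B * F * C) (A - B * K * C) B C) ↔
        DescriptorSystem.SolvabilityConditions E A B C Ta Sb r)) := by
  have necessity {K F : Matrix (Fin m) (Fin m) ℂ} :=
    DescriptorSystem.solvabilityConditions_of_feedback (K := K) (F := F) hTa hSb
  refine ⟨⟨?_, fun hcond => ?_⟩, fun Q hQ => ⟨?_, DescriptorSystem.exists_feedback hQ hTa hSb⟩⟩
  · rintro ⟨K, F, -, himp, hstab, rfl, -⟩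
    exact necessity himp hstab
  · obtain ⟨Q, hQ⟩ := hpH
    obtain ⟨K, F, hreg, himp, hstab, hr, hcl⟩ := DescriptorSystem.exists_feedback hQ hTa hSb hcond
    exact ⟨K, F, hreg, himp, hstab, hr, Q, hcl⟩
  · rintro ⟨K, F, -, himp, hstab, rfl, -⟩
    exact necessity himp hstab
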